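/- Let $G=(V,E)$ be a finite simple graph with $n=|V|$ nodes, let $0<\epsilon<1$, $\delta>0$, $\gamma>0$, let $K\ge 1$ be an integer, and put $\alpha=1+3\epsilon$, $\beta=1+\epsilon$, $L=\lceil\log_\beta(n/\alpha)\rceil$ and $L'=\lceil\log_\beta(2L^4/(\alpha\beta))\rceil$. Assume that $L\ge 1$ and $L^2\ge 4/\epsilon$. For a set $F$ of edges let $\deg(v,F)$ be the number of edges of $F$ incident to $v$. For an integer $i$ put $d_i=\beta^i\cdot\alpha\beta$. For real $d>0$ put $L_d=\lceil\log_2(d/L^4)\rceil$ and define $\lambda_d$ by $2^{L_d}=d/(\lambda_dL^4)$. Put $$h_0=e^{-\gamma}(1+4\epsilon)^{-1},\quad h_1=h_0e^{-\gamma}\big((\alpha\beta)^{-1}-3\epsilon\big),\quad h_2=\Big(1-\frac{32\delta L^4}{\epsilon^2}\Big)\Big(h_1-\epsilon-\frac1K\Big).$$ *$(\alpha,\beta)$-partition.* Every node $v$ has a level $\ell(v)\in\{-1,0,\dots,L\}$; the level of an edge $(u,v)$ is $\max(\ell(u),\ell(v))$; $E_i$ is the set of edges of level $i$ and $G_i=(V,E_i)$.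 An edge of level $i$ has weight $1/d_i$, and $W(v,E)$ denotes the total weight of the edges incident to $v$. The levels form an $(\alpha,\beta)$-partition of $G$ if every edge has level at least $0$, $W(v,E)\le 1$ for every node $v$, and $W(v,E)\ge 1/(\alpha\beta)$ for every node $v$ with $\ell(v)\ne -1$. *Skeleton.* Let $H=(V,F)$ be a graph with $\deg(v,F)\le d$ for all $v\in V$. A tuple $(B,T,S,X)$ with $B,T,S\subseteq V$ and $X\subseteq F$ is a skeleton of $H$ (with respect to the degree bound $d$) if: (1) $B\cup T=V$ and $B\cap T=\emptyset$; (2) $\deg(v,F)>\epsilon d/L^2$ for $v\in B$; (3) $\deg(v,F)<3\epsilon d/L^2$ for $v\in T$; (4) $|S|\le 4\delta|B|$; (5) $e^{-\gamma}(\lambda_dL^4/d)\deg(v,F)\le\deg(v,X)\le e^{\gamma}(\lambda_dL^4/d)\deg(v,F)$ for $v\in B\setminus S$; (6) $\deg(v,X)\le\lambda_dL^4+2$ for all $v\in V$; (7) $\deg(v,X)\le 3\epsilon\lambda_dL^2+2$ for $v\in T\setminus S$. **Theorem.** Consider an $(\alpha,\beta)$-partition of $G$, and for every level $i\in[L',L]$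 let $(B_i,T_i,S_i,X_i)$ be a skeleton of $G_i$ with respect to the degree bound $d_i$. Let $X=\bigcup_{i=L'}^{L}X_i$ and $Y=\bigcup_{i=0}^{L'-1}E_i$. Then: 1. $\deg(v,X\cup Y)\le C\cdot L^5$ for every node $v\in V$, where $C$ is an absolute constant. 2. If moreover $h_0\ge 1/2$, $1-32\delta L^4/\epsilon^2>0$ and $h_1-\epsilon-1/K>0$, then the maximum matching size in $(V,X\cup Y)$ is a $(2/h_2)(1+\epsilon)$-approximation of that of $G$: writing $\nu$ for the maximum number of edges of a matching, $$\nu(V,X\cup Y)\le\nu(G)\le\frac{2}{h_2}(1+\epsilon)\,\nu(V,X\cup Y).$$ -/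

import Mathlib

namespace SkeletonMatching

noncomputable section

/-- The degree of the node `v` in the graph `H`. -/
def deg {V : Type*} (H : SimpleGraph V) (v : V) : ℕ := (H.neighborSet v).ncard

/-- The maximum size (number of edges) of a matching in `H`.
For a finite node set this is a supremum over a nonempty bounded set, hence a maximum. -/
def maxMatching {V : Type*} (H : SimpleGraph V) : ℕ :=
  sSup {k : ℕ | ∃ M : H.Subgraph, M.IsMatching ∧ M.edgeSet.ncard = k}

/-- The top level `L = ⌈log_β (n / α)⌉`. -/
def topLevel (α β : ℝ) (n : ℕ) : ℤ := ⌈Real.logb β ((n : ℝ) / α)⌉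

/-- The cutoff level `L' = ⌈log_β (2 L⁴ / (α β))⌉`. -/
def cutLevel (α β : ℝ) (L : ℤ) : ℤ := ⌈Real.logb β (2 * (L : ℝ) ^ 4 / (α * β))⌉

/-- The degree threshold `d_i = β ^ i * (α β)` of level `i`. -/
def degThreshold (α β : ℝ) (i : ℤ) : ℝ := β ^ i * (α * β)

/-- The graph `G_i = (V, E_i)`, where `E_i` is the set of edges `(u, v)` of `G` whose level
`max (ℓ u) (ℓ v)` is `i`. -/
def levelGraph {V : Type*} (G : SimpleGraph V) (lev : V → ℤ) (i : ℤ) : SimpleGraph V where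
  Adj u v := G.Adj u v ∧ max (lev u) (lev v) = i
  symm := ⟨fun u v h => ⟨h.1.symm, by rw [max_comm]; exact h.2⟩⟩
  loopless := ⟨fun u h => G.loopless.irrefl u h.1⟩

/-- The total weight `W(v, E)` received by the node `v` from its incident edges, where an edge of
level `i` has weight `1 / d_i`. -/
def nodeWeight {V : Type*} (G : SimpleGraph V) (α β : ℝ) (lev : V → ℤ) (v : V) : ℝ :=
  ∑ᶠ u ∈ G.neighborSet v, 1 / degThreshold α β (max (lev v) (lev u))

/-- The node levels `lev` form an `(α, β)`-partition of the graph `G`. -/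
structure IsPartition {V : Type*} [Fintype V] (G : SimpleGraph V) (α β : ℝ) (lev : V → ℤ) :
    Prop where
  neg_one_le : ∀ v, -1 ≤ lev v
  le_top : ∀ v, lev v ≤ topLevel α β (Fintype.card V)
  edge_level_nonneg : ∀ u v, G.Adj u v → 0 ≤ max (lev u) (lev v)
  weight_le : ∀ v, nodeWeight G α β lev v ≤ 1
  le_weight : ∀ v, lev v ≠ -1 → 1 / (α * β) ≤ nodeWeight G α β lev v

/-- `L_d = ⌈log₂ (d / L⁴)⌉`. -/
def layerCount (L : ℤ) (d : ℝ) : ℤ := ⌈Real.logb 2 (d / (L : ℝ) ^ 4)⌉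

/-- `λ_d`, determined by `2 ^ L_d = d / (λ_d L⁴)`. -/
def lam (L : ℤ) (d : ℝ) : ℝ := d / ((2 : ℝ) ^ layerCount L d * (L : ℝ) ^ 4)

/-- `(B, T, S, X)` is a skeleton of the graph `H`, in which all degrees are at most `d`.
The edge set `X` is given as the graph `(V, X)`. -/
structure IsSkeleton {V : Type*} (ε δ γ : ℝ) (L : ℤ) (d : ℝ) (H : SimpleGraph V)
    (B T S : Set V) (X : SimpleGraph V) : Prop where
  deg_le : ∀ v, (deg H v : ℝ) ≤ d
  subgraph : X ≤ H
  union_eq : B ∪ T = Set.univ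
  inter_eq : B ∩ T = ∅
  big : ∀ v ∈ B, ε * d / (L : ℝ) ^ 2 < deg H v
  tiny : ∀ v ∈ T, (deg H v : ℝ) < 3 * ε * d / (L : ℝ) ^ 2
  spurious : (S.ncard : ℝ) ≤ 4 * δ * B.ncard
  big_lower : ∀ v ∈ B \ S,
    Real.exp (-γ) * (lam L d * (L : ℝ) ^ 4 / d) * deg H v ≤ deg X v
  big_upper : ∀ v ∈ B \ S,
    (deg X v : ℝ) ≤ Real.exp γ * (lam L d * (L : ℝ) ^ 4 / d) * deg H v
  max_deg : ∀ v, (deg X v : ℝ) ≤ lam L d * (L : ℝ) ^ 4 + 2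
  tiny_deg : ∀ v ∈ T \ S, (deg X v : ℝ) ≤ 3 * ε * lam L d * (L : ℝ) ^ 2 + 2

/-- The parameter `h₀`. -/
def h₀ (ε γ : ℝ) : ℝ := Real.exp (-γ) * (1 + 4 * ε)⁻¹

/-- The parameter `h₁`. -/
def h₁ (α β ε γ : ℝ) : ℝ := h₀ ε γ * Real.exp (-γ) * ((α * β)⁻¹ - 3 * ε)

/-- The parameter `h₂`. -/
def h₂ (α β ε δ γ : ℝ) (K : ℕ) (L : ℤ) : ℝ :=
  (1 - 32 * δ * (L : ℝ) ^ 4 / ε ^ 2) * (h₁ α β ε γ - ε - 1 / (K : ℝ))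

end

end SkeletonMatching

open SkeletonMatching

namespace SkeletonMatching

open SimpleGraph

variable {V : Type*}

/-! Degrees: a sparsified level contributes at most `3 * L ^ 4` and there are at most `L` of them.
In `Y` every edge has weight at least `1 / d_{L'-1}`, so total weight at most 1 at a node leaves at
most `2 * L ^ 4` edges.

Matchings: by Tutte–Berge, a fractional matching obeying the odd set constraints up to `1 + ε` has
size at most `(1 + ε) * ν` (`sum_le_mul_maxMatching`). Such slack is automatic when the support is a
matching plus edges of weight at most `ε ^ 2 / 8` (`sum_add_le_mul_maxMatching`). Give each edge of
`X_i` that avoids `S_i` the weight `h₀ / (λ L ^ 4)`. These weights are tiny, sum to at most 1 at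
each node, and a node of level at least `L'` receives at least `h₁`, up to a loss caused by spurious
nodes. Take a maximum matching `M` of `G` and fill its edges inside `Y` up to saturation of one
endpoint. Every edge of `M` then carries at least `h₁` at its endpoints, up to loss; summing over
`M` compares `ν(G)` with `2 * (1 + ε) * ν(V, X ∪ Y)` (`mul_ncard_edgeSet_le_of_weights`). The total
loss is charged to the big nodes, hence to the total edge weight, which is at most `3 * ν(G)`;
smallness of `δ` makes it at most `ε * ν(G)` (`sum_skeletonLoss_le`). -/

/-! ### Matching numbers. -/

lemma bddAbove_matchingSizes [Finite V] (H : SimpleGraph V) :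
    BddAbove {k : ℕ | ∃ M : H.Subgraph, M.IsMatching ∧ M.edgeSet.ncard = k} := by
  refine ⟨Nat.card (Sym2 V), ?_⟩
  rintro k ⟨M, -, rfl⟩
  exact Set.ncard_le_card _

lemma ncard_edgeSet_le_maxMatching [Finite V] {H : SimpleGraph V} {M : H.Subgraph}
    (hM : M.IsMatching) : M.edgeSet.ncard ≤ maxMatching H :=
  le_csSup (bddAbove_matchingSizes H) ⟨M, hM, rfl⟩

lemma exists_isMatching_ncard_eq_maxMatching [Finite V] (H : SimpleGraph V) :
    ∃ M : H.Subgraph, M.IsMatching ∧ M.edgeSet.ncard = maxMatching H :=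
  Nat.sSup_mem (s := {k : ℕ | ∃ M : H.Subgraph, M.IsMatching ∧ M.edgeSet.ncard = k})
    ⟨_, ⊥, fun v hv => absurd hv (by simp), rfl⟩ (bddAbove_matchingSizes H)

lemma maxMatching_mono [Finite V] {H H' : SimpleGraph V} (h : H ≤ H') :
    maxMatching H ≤ maxMatching H' := by
  obtain ⟨M, hM, hc⟩ := exists_isMatching_ncard_eq_maxMatching H
  rw [← hc]
  have := ncard_edgeSet_le_maxMatching (hM.map_ofLE h)
  convert this using 2
  ext e
  induction e with
  | _ a b => simp

lemma ncard_verts_eq_two_mul [Finite V] {H : SimpleGraph V} {M : H.Subgraph}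
    (hM : M.IsMatching) : M.verts.ncard = 2 * M.edgeSet.ncard := by
  classical
  have := Fintype.ofFinite V
  have h := M.spanningCoe.sum_degrees_eq_twice_card_edges
  rw [Set.ncard_eq_toFinset_card' M.edgeSet]
  have h1 : M.edgeSet.toFinset = M.spanningCoe.edgeFinset := by
    ext e; simp
  rw [h1, ← h, Set.ncard_eq_toFinset_card' M.verts, Finset.card_eq_sum_ones,
    ← Finset.sum_filter_add_sum_filter_not Finset.univ (fun v => v ∈ M.verts)]
  have h2 : ∀ v ∉ M.verts, M.spanningCoe.degree v = 0 := by
    intro v hv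
    rw [← SimpleGraph.card_neighborFinset_eq_degree, Finset.card_eq_zero]
    ext w
    simp only [mem_neighborFinset, Subgraph.spanningCoe_adj, Finset.notMem_empty, iff_false]
    exact fun h => hv h.fst_mem
  have h3 : ∀ v ∈ M.verts, M.spanningCoe.degree v = 1 := by
    intro v hv
    obtain ⟨w, hw, hu⟩ := hM hv
    rw [← SimpleGraph.card_neighborFinset_eq_degree, Finset.card_eq_one]
    refine ⟨w, ?_⟩
    ext x
    simp only [mem_neighborFinset, Subgraph.spanningCoe_adj, Finset.mem_singleton]
    exact ⟨fun h => hu x h, fun h => h ▸ hw⟩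
  rw [Finset.sum_congr rfl (fun v hv => h3 v (Finset.mem_filter.mp hv).2),
    Finset.sum_eq_zero (s := Finset.univ.filter fun v => v ∉ M.verts)
      (fun v hv => h2 v (Finset.mem_filter.mp hv).2), add_zero]
  congr 1
  ext; simp

/-! ### The Tutte–Berge formula, from Tutte's theorem by adding universal nodes. -/

lemma ncard_oddComponents_congr {W : Type*} {G : SimpleGraph V} {G' : SimpleGraph W}
    (φ : G ≃g G') : G.oddComponents.ncard = G'.oddComponents.ncard := by
  have h : ∀ C : G.ConnectedComponent,
      (φ.connectedComponentEquiv C).supp.ncard = C.supp.ncard := fun C =>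
    (Nat.card_congr (C.isoEquivSupp φ)).symm
  rw [← Set.ncard_image_of_injective _ φ.connectedComponentEquiv.injective]
  congr 1
  ext C
  simp only [oddComponents, Set.mem_image, Set.mem_ofPred_eq]
  constructor
  · rintro ⟨D, hD, rfl⟩
    rwa [h]
  · intro hC
    refine ⟨φ.connectedComponentEquiv.symm C, ?_, by simp⟩
    rw [← h]
    simpa using hC

/-- The number of odd components of `G` after deleting the nodes of `A`. -/
noncomputable def oddAfterDelete (G : SimpleGraph V) (A : Set V) : ℕ :=
  ((⊤ : G.Subgraph).deleteVerts A).coe.oddComponents.ncard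

/-- The graph obtained from `G` by adding the nodes of `ι`, each adjacent to all other nodes. -/
def addUniversal (G : SimpleGraph V) (ι : Type*) : SimpleGraph (V ⊕ ι) where
  Adj a b := a ≠ b ∧ ∀ u v, a = .inl u → b = .inl v → G.Adj u v
  symm := ⟨fun _ _ h => ⟨h.1.symm, fun u v ha hb => (h.2 v u hb ha).symm⟩⟩
  loopless := ⟨fun _ h => h.1 rfl⟩

@[simp] lemma addUniversal_inl_inl {G : SimpleGraph V} {ι : Type*} {u v : V} :
    (addUniversal G ι).Adj (.inl u) (.inl v) ↔ G.Adj u v := by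
  simp only [addUniversal]
  constructor
  · exact fun h => h.2 u v rfl rfl
  · refine fun h => ⟨fun e => h.ne (Sum.inl_injective e), ?_⟩
    rintro _ _ ⟨⟩ ⟨⟩
    exact h

/-- Modulo 2, the number of odd components equals the number of surviving nodes. -/
lemma oddAfterDelete_parity [Finite V] (G : SimpleGraph V) (A : Set V) :
    Even (oddAfterDelete G A + A.ncard + Nat.card V) := by
  have h := odd_ncard_oddComponents (G := ((⊤ : G.Subgraph).deleteVerts A).coe)
  have h2 : Nat.card ((⊤ : G.Subgraph).deleteVerts A).verts + A.ncard = Nat.card V := by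
    rw [Nat.card_coe_set_eq]
    simp only [Subgraph.deleteVerts_verts, Subgraph.verts_top]
    rw [Set.ncard_sdiff_add_ncard_of_subset (Set.subset_univ _), Set.ncard_univ]
  rw [← h2]
  simp only [oddAfterDelete]
  rw [Nat.odd_iff, Nat.odd_iff] at h
  rw [Nat.even_iff]
  omega

lemma oddAfterDelete_addUniversal (G : SimpleGraph V) (ι : Type*) (A : Set V) :
    oddAfterDelete (addUniversal G ι) (Sum.inl '' A ∪ Set.range Sum.inr) = oddAfterDelete G A := by
  symm
  refine ncard_oddComponents_congr ⟨Equiv.ofBijective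
    (fun v => ⟨.inl v.1, by simpa using v.2⟩) ⟨?_, ?_⟩, ?_⟩
  · rintro ⟨v, hv⟩ ⟨w, hw⟩ h
    simpa using h
  · rintro ⟨v | j, hv⟩
    · exact ⟨⟨v, by simpa using hv⟩, rfl⟩
    · simp at hv
  · rintro ⟨v, hv⟩ ⟨w, hw⟩
    simp only [Subgraph.deleteVerts_verts, Subgraph.verts_top, Set.mem_sdiff, Set.mem_univ,
      true_and] at hv hw
    rw [Subgraph.coe_adj, Subgraph.coe_adj]
    change Subgraph.Adj _ (Sum.inl v) (Sum.inl w) ↔ _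
    simp [hv, hw]

/-- A surviving universal node is adjacent to every other survivor, so only one component is left.
-/
lemma oddAfterDelete_addUniversal_le_one (G : SimpleGraph V) {ι : Type*} [Finite V] [Finite ι]
    {U : Set (V ⊕ ι)} {j : ι} (hj : Sum.inr j ∉ U) :
    oddAfterDelete (addUniversal G ι) U ≤ 1 := by
  have hmem : Sum.inr j ∈ ((⊤ : (addUniversal G ι).Subgraph).deleteVerts U).verts := by
    simpa using hj
  have hreach : ∀ a : ((⊤ : (addUniversal G ι).Subgraph).deleteVerts U).verts,
      ((⊤ : (addUniversal G ι).Subgraph).deleteVerts U).coe.Reachable a ⟨_, hmem⟩ := by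
    rintro ⟨a, ha⟩
    by_cases hja : a = Sum.inr j
    · subst hja; rfl
    · refine Adj.reachable ?_
      have ha' : a ∉ U := by simpa using ha
      rw [Subgraph.coe_adj, Subgraph.deleteVerts_adj]
      exact ⟨trivial, ha', trivial, hj, hja, fun u v _ h => by cases h⟩
  have : Subsingleton ((⊤ : (addUniversal G ι).Subgraph).deleteVerts U).coe.ConnectedComponent := by
    refine ⟨fun C D => ?_⟩
    induction C using ConnectedComponent.ind with | _ a
    induction D using ConnectedComponent.ind with | _ b
    exact ConnectedComponent.eq.mpr ((hreach a).trans (hreach b).symm)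
  exact Set.ncard_le_one_of_subsingleton _

/-- Keep the edges of `P` inside `V`; the nodes lost this way have distinct partners in `ι`. -/
lemma exists_isMatching_of_addUniversal [Finite V] {G : SimpleGraph V} {ι : Type*} [Finite ι]
    {P : (addUniversal G ι).Subgraph} (hP : P.IsPerfectMatching) :
    ∃ M : G.Subgraph, M.IsMatching ∧ Nat.card V ≤ M.verts.ncard + Nat.card ι := by
  have hP' := Subgraph.isPerfectMatching_iff.mp hP
  let M : G.Subgraph :=
    { verts := {v | ∃ w, P.Adj (.inl v) (.inl w)}
      Adj := fun u v => P.Adj (.inl u) (.inl v)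
      adj_sub := fun h => addUniversal_inl_inl.mp (P.adj_sub h)
      edge_vert := fun {v w} h => ⟨w, h⟩
      symm := ⟨fun _ _ h => h.symm⟩ }
  refine ⟨M, ?_, ?_⟩
  · rintro v ⟨w, hw⟩
    exact ⟨w, hw, fun x hx => Sum.inl_injective (hP.1.eq_of_adj_left hx hw)⟩
  · have hpart : ∀ v : ↥(M.vertsᶜ), ∃ j : ι, P.Adj (.inl v.1) (.inr j) := by
      rintro ⟨v, hv⟩
      obtain ⟨w | j, hw, -⟩ := hP' (.inl v)
      · exact absurd ⟨w, hw⟩ hv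
      · exact ⟨j, hw⟩
    choose f hf using hpart
    have hinj : Function.Injective f := by
      intro a b hab
      have h1 := hf a
      rw [hab] at h1
      exact Subtype.ext (Sum.inl_injective (hP.1.eq_of_adj_right h1 (hf b)))
    have h1 := Nat.card_le_card_of_injective f hinj
    rw [Nat.card_coe_set_eq] at h1
    have h2 := Set.ncard_add_ncard_compl M.verts
    omega

/-- The nontrivial direction of the **Tutte–Berge formula**. -/
theorem exists_card_add_ncard_le_two_mul_maxMatching [Finite V] (G : SimpleGraph V) :
    ∃ A : Set V, Nat.card V + A.ncard ≤ 2 * maxMatching G + oddAfterDelete G A := by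
  -- `A` maximizes the deficiency `d`, which is nonnegative by comparison with `∅`; adding `d`
  -- universal nodes then yields a perfect matching.
  obtain ⟨A, hA⟩ := Finite.exists_max (fun A : Set V => (oddAfterDelete G A : ℤ) - A.ncard)
  have h0 := hA ∅
  simp only [Set.ncard_empty] at h0
  obtain ⟨d, hd⟩ : ∃ d : ℕ, (d : ℤ) = oddAfterDelete G A - A.ncard :=
    ⟨((oddAfterDelete G A : ℤ) - A.ncard).toNat, by omega⟩
  have hpar := oddAfterDelete_parity G A
  have hpm : ∃ P : (addUniversal G (Fin d)).Subgraph, P.IsPerfectMatching := by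
    rw [tutte]
    intro U hU
    change U.ncard < oddAfterDelete (addUniversal G (Fin d)) U at hU
    -- If `U` misses a new node, a violation forces `U = ∅` and one odd component, but `Nat.card V +
    -- d` is even. If `U` contains all new nodes, its trace on `V` has deficiency above `d`, against
    -- maximality.
    by_cases hj : ∃ j, Sum.inr j ∉ U
    · obtain ⟨j, hj⟩ := hj
      have h1 := oddAfterDelete_addUniversal_le_one G hj
      have h2 := oddAfterDelete_parity (addUniversal G (Fin d)) U
      rw [Nat.card_sum, Nat.card_fin] at h2
      rw [Nat.even_iff] at hpar h2
      omega
    · push Not at hj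
      have hUeq : U = Sum.inl '' (Sum.inl ⁻¹' U) ∪ Set.range (Sum.inr : Fin d → V ⊕ Fin d) := by
        ext (v | j)
        · simp
        · simp [hj]
      generalize (Sum.inl ⁻¹' U : Set V) = W at hUeq
      subst hUeq
      rw [oddAfterDelete_addUniversal] at hU
      have h1 : (Sum.inl '' W ∪ Set.range (Sum.inr : Fin d → V ⊕ Fin d)).ncard =
          W.ncard + d := by
        rw [Set.ncard_union_eq, Set.ncard_image_of_injective _ Sum.inl_injective,
          ← Set.image_univ, Set.ncard_image_of_injective _ Sum.inr_injective, Set.ncard_univ,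
          Nat.card_fin]
        rw [Set.disjoint_left]
        rintro _ ⟨v, -, rfl⟩ ⟨j, hj⟩
        simp at hj
      have := hA W
      omega
  obtain ⟨P, hP⟩ := hpm
  obtain ⟨M, hM, hcard⟩ := exists_isMatching_of_addUniversal hP
  have h1 := ncard_edgeSet_le_maxMatching hM
  rw [ncard_verts_eq_two_mul hM, Nat.card_fin] at hcard
  exact ⟨A, by omega⟩

/-! ### Fractional matchings and relaxed odd set constraints. -/

/-- If the weights `z` vanish between different components of `D`, satisfy the degree constraints
and satisfy the odd set constraints up to `1 + η`, then their total is bounded by the number of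
nodes minus the number of odd components of `D`. -/
lemma sum_le_card_sub_oddComponents {W : Type*} [Fintype W] (D : SimpleGraph W) {z : W → W → ℝ}
    {η : ℝ} (hη : 0 ≤ η) (h0 : ∀ u v, 0 ≤ z u v) (hsupp : ∀ u v, z u v ≠ 0 → D.Adj u v)
    (hrow : ∀ v, ∑ u, z v u ≤ 1)
    (hodd : ∀ U : Finset W, Odd U.card → ∑ u ∈ U, ∑ v ∈ U, z u v ≤ (1 + η) * (U.card - 1)) :
    ∑ u, ∑ v, z u v ≤ (1 + η) * (Fintype.card W - D.oddComponents.ncard) := by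
  classical
  have := Fintype.ofFinite D.ConnectedComponent
  let F : D.ConnectedComponent → Finset W :=
    fun C => Finset.univ.filter fun u => D.connectedComponentMk u = C
  have hF : ∀ C, C.supp.ncard = (F C).card := by
    intro C
    rw [← Set.ncard_coe_finset]
    congr 1
    ext u
    simp [F]
  have h1 : ∑ u, ∑ v, z u v = ∑ C, ∑ u ∈ F C, ∑ v ∈ F C, z u v := by
    rw [← Finset.sum_fiberwise Finset.univ D.connectedComponentMk]
    refine Finset.sum_congr rfl fun C _ => Finset.sum_congr rfl fun u hu => ?_
    symm
    refine Finset.sum_subset (Finset.subset_univ _) fun v _ hv => ?_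
    by_contra hz
    apply hv
    simp only [Finset.mem_filter, Finset.mem_univ, true_and, F] at hu ⊢
    rw [← hu]
    exact (ConnectedComponent.sound (hsupp u v hz).reachable).symm
  -- Odd components use the odd set constraint, which saves 1; the others only the degree
  -- constraints.
  have h2 : ∀ C, ∑ u ∈ F C, ∑ v ∈ F C, z u v ≤
      (1 + η) * ((F C).card - if C ∈ D.oddComponents then 1 else 0) := by
    intro C
    split_ifs with hC
    · exact hodd _ (by rw [← hF]; exact hC)
    · calc ∑ u ∈ F C, ∑ v ∈ F C, z u v ≤ ∑ u ∈ F C, (1 : ℝ) :=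
            Finset.sum_le_sum fun u _ => (Finset.sum_le_sum_of_subset_of_nonneg
              (Finset.subset_univ _) fun v _ _ => h0 u v).trans (hrow u)
        _ = (F C).card := by simp
        _ ≤ (1 + η) * ((F C).card - 0) := by nlinarith [(F C).card.cast_nonneg (α := ℝ)]
  rw [h1]
  refine (Finset.sum_le_sum fun C _ => h2 C).trans_eq ?_
  rw [← Finset.mul_sum, Finset.sum_sub_distrib]
  congr 2
  · rw [← Nat.cast_sum, ← Finset.card_univ,
      Finset.card_eq_sum_card_fiberwise (f := D.connectedComponentMk) (t := Finset.univ)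
        (fun _ _ => Finset.mem_coe.mpr (Finset.mem_univ _))]
  · rw [Finset.sum_boole, Set.ncard_eq_toFinset_card']
    congr 2
    ext; simp

/-- A fractional matching that satisfies the odd set constraints up to a factor `1 + η` is at most
`1 + η` times as large as a maximum matching. Sums run over ordered pairs of nodes. -/
theorem sum_le_mul_maxMatching [Fintype V] (H : SimpleGraph V) {z : V → V → ℝ}
    {η : ℝ} (hη : 0 ≤ η) (h0 : ∀ u v, 0 ≤ z u v) (hsymm : ∀ u v, z u v = z v u)
    (hsupp : ∀ u v, z u v ≠ 0 → H.Adj u v) (hrow : ∀ v, ∑ u, z v u ≤ 1)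
    (hodd : ∀ U : Finset V, Odd U.card → ∑ u ∈ U, ∑ v ∈ U, z u v ≤ (1 + η) * (U.card - 1)) :
    ∑ u, ∑ v, z u v ≤ 2 * (1 + η) * maxMatching H := by
  classical
  obtain ⟨A, hA⟩ := exists_card_add_ncard_le_two_mul_maxMatching H
  set D := (⊤ : H.Subgraph).deleteVerts A with hD
  have hmem : ∀ v, v ∈ D.verts ↔ v ∉ A := by intro v; simp [hD]
  have hsub : ∑ u : D.verts, ∑ v : D.verts, z u v ≤
      (1 + η) * (Fintype.card D.verts - oddAfterDelete H A) := by
    refine sum_le_card_sub_oddComponents D.coe hη (fun u v => h0 u v) ?_ ?_ ?_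
    · intro u v huv
      rw [Subgraph.coe_adj]
      refine Subgraph.deleteVerts_adj.mpr ⟨trivial, (hmem _).mp u.2, trivial, (hmem _).mp v.2, hsupp _ _ huv⟩
    · intro v
      refine le_trans ?_ (hrow v)
      rw [← Finset.sum_subtype (p := (· ∈ D.verts)) D.verts.toFinset (fun x => by simp)
        (fun u => z v u)]
      exact Finset.sum_le_sum_of_subset_of_nonneg (Finset.subset_univ _) fun u _ _ => h0 _ u
    · intro U hU
      have := hodd (U.map (Function.Embedding.subtype _)) (by simpa using hU)
      simpa using this
  have hcard : Fintype.card D.verts + A.ncard = Nat.card V := by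
    rw [← Nat.card_eq_fintype_card, Nat.card_coe_set_eq, ← Set.ncard_add_ncard_compl A, add_comm]
    congr 2
    ext v; simp [hmem]
  -- Ordered pairs meeting `A` are covered by the rows and the columns of `A`, each of sum at most
  -- 1.
  have hsplit : ∑ u, ∑ v, z u v ≤ 2 * A.ncard + ∑ u : D.verts, ∑ v : D.verts, z u v := by
    have e1 : ∑ u : D.verts, ∑ v : D.verts, z u v =
        ∑ u ∈ Finset.univ.filter (· ∉ A), ∑ v ∈ Finset.univ.filter (· ∉ A), z u v := by
      rw [Finset.sum_subtype (p := (· ∈ D.verts)) (Finset.univ.filter (· ∉ A))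
        (fun x => by simp [hmem])]
      refine Finset.sum_congr rfl fun u _ => ?_
      rw [Finset.sum_subtype (p := (· ∈ D.verts)) (Finset.univ.filter (· ∉ A))
        (fun x => by simp [hmem])]
    have hAc : ∑ u ∈ Finset.univ.filter (· ∈ A), ∑ v, z u v ≤ A.ncard := by
      refine (Finset.sum_le_sum fun u _ => hrow u).trans_eq ?_
      rw [Set.ncard_eq_toFinset_card']
      simp
    have hsw : ∑ u ∈ Finset.univ.filter (· ∉ A), ∑ v ∈ Finset.univ.filter (· ∈ A), z u v ≤
        A.ncard := by
      rw [Finset.sum_comm]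
      refine le_trans (Finset.sum_le_sum fun v _ => ?_) hAc
      simp_rw [hsymm _ v]
      exact Finset.sum_le_sum_of_subset_of_nonneg (Finset.subset_univ _) fun u _ _ => h0 _ u
    rw [e1, ← Finset.sum_filter_add_sum_filter_not Finset.univ (· ∈ A)]
    have e2 : ∑ u ∈ Finset.univ.filter (· ∉ A), ∑ v, z u v =
        ∑ u ∈ Finset.univ.filter (· ∉ A), ∑ v ∈ Finset.univ.filter (· ∈ A), z u v +
        ∑ u ∈ Finset.univ.filter (· ∉ A), ∑ v ∈ Finset.univ.filter (· ∉ A), z u v := by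
      rw [← Finset.sum_add_distrib]
      refine Finset.sum_congr rfl fun u _ => ?_
      rw [Finset.sum_filter_add_sum_filter_not]
    rw [e2]
    linarith
  have hA' : (Nat.card V : ℝ) + A.ncard ≤ 2 * maxMatching H + oddAfterDelete H A := by
    exact_mod_cast hA
  have hcard' : (Fintype.card D.verts : ℝ) + A.ncard = Nat.card V := by exact_mod_cast hcard
  have : (0 : ℝ) ≤ A.ncard := Nat.cast_nonneg _
  nlinarith [mul_le_mul_of_nonneg_left hA' (by linarith : 0 ≤ 1 + η)]

/-- The total weight of a fractional matching is at most `3 / 2` times the maximum matching size. -/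
theorem sum_le_three_mul_maxMatching [Fintype V] (H : SimpleGraph V) {z : V → V → ℝ}
    (h0 : ∀ u v, 0 ≤ z u v) (hsymm : ∀ u v, z u v = z v u)
    (hsupp : ∀ u v, z u v ≠ 0 → H.Adj u v) (hrow : ∀ v, ∑ u, z v u ≤ 1) :
    ∑ u, ∑ v, z u v ≤ 3 * maxMatching H := by
  -- With `η = 1 / 2` the degree constraints suffice: `2k + 1 ≤ 3k` for `k ≥ 1`, and singletons
  -- carry no weight for lack of loops.
  have := sum_le_mul_maxMatching H (η := 1 / 2) (by norm_num) h0 hsymm hsupp hrow ?_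
  · linarith
  intro U hU
  obtain ⟨k, hk⟩ := hU
  rcases Nat.eq_zero_or_pos k with rfl | hk0
  · obtain ⟨a, rfl⟩ := Finset.card_eq_one.mp hk
    have : z a a = 0 := by
      by_contra h
      exact (hsupp a a h).ne rfl
    simp [this]
  · have : ∑ u ∈ U, ∑ v ∈ U, z u v ≤ ∑ u ∈ U, (1 : ℝ) :=
      Finset.sum_le_sum fun u _ => (Finset.sum_le_sum_of_subset_of_nonneg
        (Finset.subset_univ _) fun v _ _ => h0 u v).trans (hrow u)
    refine this.trans ?_
    have h1 : (1 : ℝ) ≤ k := by exact_mod_cast hk0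
    simp only [Finset.sum_const, nsmul_eq_mul, mul_one, hk]
    push_cast
    linarith

/-- A fractional matching supported on a matching `P` and on further
edges of weight at most `ε ^ 2 / 8` is at most `1 + ε` times as large as a maximum matching. -/
theorem sum_add_le_mul_maxMatching [Fintype V] (H : SimpleGraph V) {x y : V → V → ℝ}
    {ε : ℝ} (hε : 0 < ε) (hε1 : ε ≤ 1) (hx0 : ∀ u v, 0 ≤ x u v) (hy0 : ∀ u v, 0 ≤ y u v)
    (hxsymm : ∀ u v, x u v = x v u) (hysymm : ∀ u v, y u v = y v u)
    (hxsupp : ∀ u v, x u v ≠ 0 → H.Adj u v) (hxle : ∀ u v, x u v ≤ ε ^ 2 / 8) {P : H.Subgraph} (hP : P.IsMatching)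
    (hysupp : ∀ u v, y u v ≠ 0 → P.Adj u v)
    (hrow : ∀ v, ∑ u, (x v u + y v u) ≤ 1) :
    ∑ u, ∑ v, (x u v + y u v) ≤ 2 * (1 + ε) * maxMatching H := by
  classical
  refine sum_le_mul_maxMatching H hε.le (fun u v => add_nonneg (hx0 u v) (hy0 u v))
    (fun u v => by rw [hxsymm, hysymm]) (fun u v h => ?_) hrow fun U hU => ?_
  · by_cases hx : x u v = 0
    · exact P.adj_sub (hysupp u v (by simpa [hx] using h))
    · exact hxsupp u v hx
  have hUc := hU
  obtain ⟨k, hk⟩ := hU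
  rw [hk]
  push_cast
  have hk0 : (0 : ℝ) ≤ k := Nat.cast_nonneg k
  -- For a large set of `2k + 1` nodes the degree bound is already at most `(1 + ε) * 2k`. In a
  -- small set there are too few pairs for `x` to exceed `2kε`, while `y` contributes at most `2k`.
  rcases le_or_gt 1 (2 * k * ε) with hbig | hsmall
  · have : ∑ u ∈ U, ∑ v ∈ U, (x u v + y u v) ≤ ∑ u ∈ U, (1 : ℝ) :=
      Finset.sum_le_sum fun u _ => (Finset.sum_le_sum_of_subset_of_nonneg
        (Finset.subset_univ _) fun v _ _ => add_nonneg (hx0 u v) (hy0 u v)).trans (hrow u)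
    refine this.trans ?_
    simp only [Finset.sum_const, nsmul_eq_mul, mul_one, hk]
    push_cast
    linarith
  · have hxs : ∑ u ∈ U, ∑ v ∈ U, x u v ≤ (2 * k + 1) * (2 * k) * (ε ^ 2 / 8) := by
      have h1 : ∀ u ∈ U, ∑ v ∈ U, x u v ≤ 2 * k * (ε ^ 2 / 8) := by
        intro u hu
        have hxx : x u u = 0 := by
          by_contra h
          exact (hxsupp u u h).ne rfl
        rw [← Finset.add_sum_erase U _ hu, hxx, zero_add]
        refine (Finset.sum_le_sum fun v _ => hxle u v).trans_eq ?_
        rw [Finset.sum_const, Finset.card_erase_of_mem hu, hk]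
        simp
      refine (Finset.sum_le_sum h1).trans_eq ?_
      rw [Finset.sum_const, hk, nsmul_eq_mul]
      push_cast
      ring
    have hys : ∑ u ∈ U, ∑ v ∈ U, y u v ≤ 2 * k := by
      have hrow1 : ∀ u, ∑ v ∈ U, y u v ≤ 1 := fun u =>
        (Finset.sum_le_sum_of_subset_of_nonneg (Finset.subset_univ _) fun v _ _ => hy0 u v).trans
          ((Finset.sum_le_sum fun v _ => le_add_of_nonneg_left (hx0 u v)).trans (hrow u))
      -- A matching cannot cover an odd set from within, so some row of `y` vanishes on `U`.
      by_cases h : ∀ u ∈ U, ∃ v ∈ U, P.Adj u v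
      · have hQ : (P.induce (U : Set V)).IsMatching := by
          intro u hu
          obtain ⟨v, hv, huv⟩ := h u (by simpa using hu)
          refine ⟨v, ⟨hu, by simpa using hv, huv⟩, fun w hw => hP.eq_of_adj_left hw.2.2 huv⟩
        have := hQ.even_card
        simp only [Subgraph.induce_verts, Finset.toFinset_coe] at this
        exact absurd this (Nat.not_even_iff_odd.mpr hUc)
      · push Not at h
        obtain ⟨u, hu, hun⟩ := h
        rw [← Finset.add_sum_erase U _ hu, Finset.sum_eq_zero fun v hv => by
          by_contra hne
          exact hun v hv (hysupp u v hne), zero_add]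
        refine (Finset.sum_le_sum fun v _ => hrow1 v).trans_eq ?_
        rw [Finset.sum_const, Finset.card_erase_of_mem hu, hk]
        simp
    simp_rw [Finset.sum_add_distrib]
    nlinarith [mul_nonneg hk0 hε.le]

/-! ### Degrees as sums, and the rounding factor `λ`. -/

open Classical in
lemma deg_eq_sum [Fintype V] (H : SimpleGraph V) (v : V) :
    (deg H v : ℝ) = ∑ u, if H.Adj v u then 1 else 0 := by
  rw [deg, Set.ncard_eq_toFinset_card', Finset.sum_boole]
  congr 2
  ext; simp

open Classical in
lemma deg_mul_eq_sum [Fintype V] (H : SimpleGraph V) (v : V) (c : ℝ) :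
    deg H v * c = ∑ u, if H.Adj v u then c else 0 := by
  rw [deg_eq_sum, Finset.sum_mul]
  simp only [ite_mul, one_mul, zero_mul]

lemma degThreshold_pos {α β : ℝ} (hα : 0 < α) (hβ : 0 < β) (i : ℤ) : 0 < degThreshold α β i := by
  unfold degThreshold; positivity

lemma lam_pos {L : ℤ} {d : ℝ} (hL : 1 ≤ L) (hd : 0 < d) : 0 < lam L d := by
  have : (1 : ℝ) ≤ L := by exact_mod_cast hL
  unfold lam; positivity

/-- `λ` is the error of rounding `d / L ^ 4` up to a power of 2; hence it lies in `(1/2, 1]`. -/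
lemma lam_le_one {L : ℤ} {d : ℝ} (hL : 1 ≤ L) (hd : 0 < d) : lam L d ≤ 1 := by
  have h1 : (1 : ℝ) ≤ L := by exact_mod_cast hL
  unfold lam
  rw [div_le_one (by positivity), ← div_le_iff₀ (by positivity)]
  have := Int.le_ceil (Real.logb 2 (d / (L : ℝ) ^ 4))
  rw [Real.logb_le_iff_le_rpow (by norm_num) (by positivity), Real.rpow_intCast] at this
  exact this

lemma half_lt_lam {L : ℤ} {d : ℝ} (hL : 1 ≤ L) (hd : 0 < d) : 1 / 2 < lam L d := by
  have h1 : (1 : ℝ) ≤ L := by exact_mod_cast hL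
  unfold lam
  have := Int.ceil_lt_add_one (Real.logb 2 (d / (L : ℝ) ^ 4))
  have h2 : ((layerCount L d - 1 : ℤ) : ℝ) < Real.logb 2 (d / (L : ℝ) ^ 4) := by
    unfold layerCount; push_cast; linarith
  rw [Real.lt_logb_iff_rpow_lt (by norm_num) (by positivity), Real.rpow_intCast,
    zpow_sub_one₀ (by norm_num), lt_div_iff₀ (by positivity)] at h2
  rw [lt_div_iff₀ (by positivity)]
  linarith

/-! ### Weights and losses on a single sparsified level. -/

open Classical in
/-- The weights on a sparsified level `X`: every edge without an endpoint in `S` gets weight `c`. -/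
noncomputable def layerWeight (c : ℝ) (X : SimpleGraph V) (S : Set V) (u v : V) : ℝ :=
  if X.Adj u v ∧ u ∉ S ∧ v ∉ S then c else 0

open Classical in
/-- An upper bound for the weight missing at `v` because of the spurious nodes in `S`. -/
noncomputable def layerLoss [Fintype V] (c : ℝ) (X : SimpleGraph V) (S : Set V) (v : V) : ℝ :=
  (if v ∈ S then 1 else 0) + ∑ u, if X.Adj v u ∧ u ∈ S then c else 0

lemma layerWeight_nonneg {c : ℝ} (hc : 0 ≤ c) (X : SimpleGraph V) (S : Set V) (u v : V) :
    0 ≤ layerWeight c X S u v := by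
  unfold layerWeight; split_ifs <;> simp [hc]

lemma layerWeight_comm (c : ℝ) (X : SimpleGraph V) (S : Set V) (u v : V) :
    layerWeight c X S u v = layerWeight c X S v u := by
  have h : (X.Adj u v ∧ u ∉ S ∧ v ∉ S) = (X.Adj v u ∧ v ∉ S ∧ u ∉ S) := by
    rw [X.adj_comm u v, and_comm (a := u ∉ S)]
  unfold layerWeight
  by_cases h1 : X.Adj v u ∧ v ∉ S ∧ u ∉ S
  · rw [if_pos h1, if_pos (h ▸ h1)]
  · rw [if_neg h1, if_neg (h ▸ h1)]

lemma layerLoss_nonneg [Fintype V] {c : ℝ} (hc : 0 ≤ c) (X : SimpleGraph V) (S : Set V) (v : V) :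
    0 ≤ layerLoss c X S v := by
  unfold layerLoss
  refine add_nonneg (by split_ifs <;> simp) (Finset.sum_nonneg fun u _ => ?_)
  split_ifs <;> simp [hc]

lemma sum_layerWeight_le [Fintype V] {c : ℝ} (hc : 0 ≤ c) (X : SimpleGraph V) (S : Set V) (v : V) :
    ∑ u, layerWeight c X S v u ≤ deg X v * c := by
  classical
  rw [deg_mul_eq_sum]
  refine Finset.sum_le_sum fun u _ => ?_
  unfold layerWeight
  split_ifs with h1 h2 <;> first | exact le_rfl | exact hc | exact absurd h1.1 h2

lemma sum_layerWeight_of_mem [Fintype V] (c : ℝ) (X : SimpleGraph V) {S : Set V} {v : V}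
    (hv : v ∈ S) : ∑ u, layerWeight c X S v u = 0 :=
  Finset.sum_eq_zero fun u _ => by simp [layerWeight, hv]

lemma sum_layerWeight_add_layerLoss [Fintype V] (c : ℝ) (X : SimpleGraph V) {S : Set V} {v : V}
    (hv : v ∉ S) : ∑ u, layerWeight c X S v u + layerLoss c X S v = deg X v * c := by
  classical
  rw [deg_mul_eq_sum, layerLoss, if_neg hv, zero_add, ← Finset.sum_add_distrib]
  refine Finset.sum_congr rfl fun u _ => ?_
  by_cases hu : u ∈ S <;> simp [layerWeight, hv, hu]

/-- Double counting: each spurious node costs 1 for itself and `deg X v * c ≤ D` at its neighbours.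
-/
lemma sum_layerLoss_le [Fintype V] {c D : ℝ} (X : SimpleGraph V) {S : Set V}
    (hD : ∀ v, deg X v * c ≤ D) : ∑ v, layerLoss c X S v ≤ S.ncard * (1 + D) := by
  classical
  simp only [layerLoss, Finset.sum_add_distrib]
  have h1 : ∑ v, (if v ∈ S then (1 : ℝ) else 0) = S.ncard := by
    rw [Finset.sum_boole, Set.ncard_eq_toFinset_card']
    congr 2
    ext; simp
  have h2 : ∑ v, ∑ u, (if X.Adj v u ∧ u ∈ S then c else 0) ≤ S.ncard * D := by
    rw [Finset.sum_comm, ← h1, Finset.sum_mul]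
    refine Finset.sum_le_sum fun u _ => ?_
    by_cases hu : u ∈ S
    · simp only [hu, and_true, if_true, one_mul]
      refine le_trans (le_of_eq ?_) (hD u)
      rw [deg_mul_eq_sum]
      simp only [X.adj_comm u]
    · simp [hu]
  rw [h1]
  linarith

lemma IsSkeleton.mem_or_mem {ε δ γ : ℝ} {L : ℤ} {d : ℝ}
    {H X : SimpleGraph V} {B T S : Set V} (hs : IsSkeleton ε δ γ L d H B T S X)
    (v : V) : v ∈ B ∨ v ∈ T := by
  have := Set.mem_univ v
  rwa [← hs.union_eq] at this

/-- The two error terms account for tiny nodes; the additive 2 in their degree bound becomes `4 / L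
^ 4` because `λ > 1/2`. -/
lemma IsSkeleton.deg_mul_le_of_notMem {ε δ γ : ℝ} {L : ℤ} {d h : ℝ}
    {H X : SimpleGraph V} {B T S : Set V} (hs : IsSkeleton ε δ γ L d H B T S X) (hε : 0 < ε)
    (hL : 1 ≤ L) (hd : 0 < d) (hh : 0 ≤ h) {v : V} (hv : v ∉ S) :
    deg X v * (h / (lam L d * (L : ℝ) ^ 4)) ≤
      h * (Real.exp γ * (deg H v / d) + (3 * ε / (L : ℝ) ^ 2 + 4 / (L : ℝ) ^ 4)) := by
  have hL1 : (1 : ℝ) ≤ L := by exact_mod_cast hL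
  have hl := lam_pos hL hd
  have hl2 := half_lt_lam hL hd
  have hr : 0 < lam L d * (L : ℝ) ^ 4 := by positivity
  rw [mul_div_assoc', mul_comm, mul_div_assoc]
  refine mul_le_mul_of_nonneg_left ?_ hh
  rcases hs.mem_or_mem v with hB | hT
  · have h1 := hs.big_upper v ⟨hB, hv⟩
    have h2 : (deg X v : ℝ) / (lam L d * (L : ℝ) ^ 4) ≤ Real.exp γ * (deg H v / d) := by
      rw [div_le_iff₀ hr]
      refine h1.trans (le_of_eq ?_)
      ring
    refine h2.trans (le_add_of_nonneg_right (by positivity))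
  · have h1 := hs.tiny_deg v ⟨hT, hv⟩
    have h2 : (deg X v : ℝ) / (lam L d * (L : ℝ) ^ 4) ≤
        3 * ε / (L : ℝ) ^ 2 + 4 / (L : ℝ) ^ 4 := by
      rw [div_le_iff₀ hr]
      refine h1.trans ?_
      have e : (3 * ε / (L : ℝ) ^ 2 + 4 / (L : ℝ) ^ 4) * (lam L d * (L : ℝ) ^ 4) =
        3 * ε * lam L d * (L : ℝ) ^ 2 + 4 * lam L d := by field_simp
      rw [e]
      linarith
    refine h2.trans (le_add_of_nonneg_left (by positivity))

section Skeleton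

variable [Fintype V] {ε δ γ : ℝ} {L : ℤ} {d h : ℝ} {H X : SimpleGraph V} {B T S : Set V}

lemma IsSkeleton.sum_layerWeight_le (hs : IsSkeleton ε δ γ L d H B T S X) (hε : 0 < ε)
    (hL : 1 ≤ L) (hd : 0 < d) (hh : 0 ≤ h) (v : V) :
    ∑ u, layerWeight (h / (lam L d * (L : ℝ) ^ 4)) X S v u ≤
      h * (Real.exp γ * (deg H v / d) + (3 * ε / (L : ℝ) ^ 2 + 4 / (L : ℝ) ^ 4)) := by
  have hL1 : (1 : ℝ) ≤ L := by exact_mod_cast hL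
  have hl := lam_pos hL hd
  by_cases hv : v ∈ S
  · rw [sum_layerWeight_of_mem _ _ hv]
    positivity
  · exact (SkeletonMatching.sum_layerWeight_le (by positivity) X S v).trans
      (hs.deg_mul_le_of_notMem hε hL hd hh hv)

/-- For a spurious node the loss is at least 1 and pays alone; for a big node the degree is
preserved up to `exp (-γ)`; for a tiny node the left side is not positive. -/
lemma IsSkeleton.le_sum_layerWeight_add_layerLoss (hs : IsSkeleton ε δ γ L d H B T S X)
    (hε : 0 < ε) (hγ : 0 < γ) (hL : 1 ≤ L) (hd : 0 < d) (hh : 0 ≤ h) (hh1 : h ≤ 1) (v : V) :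
    h * Real.exp (-γ) * (deg H v / d - 3 * ε / (L : ℝ) ^ 2) ≤
      ∑ u, layerWeight (h / (lam L d * (L : ℝ) ^ 4)) X S v u +
        layerLoss (h / (lam L d * (L : ℝ) ^ 4)) X S v := by
  classical
  have hL1 : (1 : ℝ) ≤ L := by exact_mod_cast hL
  have hl := lam_pos hL hd
  have hr : 0 < lam L d * (L : ℝ) ^ 4 := by positivity
  have he : Real.exp (-γ) ≤ 1 := by simpa using hγ.le
  have he0 := Real.exp_pos (-γ)
  have hE : 0 ≤ 3 * ε / (L : ℝ) ^ 2 := by positivity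
  by_cases hv : v ∈ S
  · rw [sum_layerWeight_of_mem _ _ hv, zero_add]
    have h1 : 1 ≤ layerLoss (h / (lam L d * (L : ℝ) ^ 4)) X S v := by
      unfold layerLoss
      rw [if_pos hv]
      refine le_add_of_nonneg_right (Finset.sum_nonneg fun u _ => ?_)
      split_ifs <;> positivity
    have h2 : (deg H v : ℝ) / d ≤ 1 := (div_le_one hd).mpr (hs.deg_le v)
    have h3 : h * Real.exp (-γ) ≤ 1 := mul_le_one₀ hh1 he0.le he
    have h4 : 0 ≤ h * Real.exp (-γ) := by positivity
    nlinarith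
  · rw [SkeletonMatching.sum_layerWeight_add_layerLoss _ _ hv]
    rcases hs.mem_or_mem v with hB | hT
    · have h1 := hs.big_lower v ⟨hB, hv⟩
      calc h * Real.exp (-γ) * (deg H v / d - 3 * ε / (L : ℝ) ^ 2)
          ≤ h * Real.exp (-γ) * (deg H v / d) := by gcongr; linarith
        _ = Real.exp (-γ) * (lam L d * (L : ℝ) ^ 4 / d) * deg H v *
            (h / (lam L d * (L : ℝ) ^ 4)) := by field_simp
        _ ≤ _ := by gcongr
    · have h1 := hs.tiny v hT
      have h2 : (deg H v : ℝ) / d - 3 * ε / (L : ℝ) ^ 2 ≤ 0 := by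
        rw [sub_nonpos, div_le_iff₀ hd]
        refine h1.le.trans (le_of_eq ?_)
        ring
      exact (mul_nonpos_of_nonneg_of_nonpos (by positivity) h2).trans (by positivity)

lemma IsSkeleton.ncard_big_mul_le (hs : IsSkeleton ε δ γ L d H B T S X) (hd : 0 < d) :
    B.ncard * (ε / (L : ℝ) ^ 2) ≤ ∑ v, (deg H v : ℝ) / d := by
  classical
  have h1 : (B.ncard : ℝ) * (ε / (L : ℝ) ^ 2) = ∑ v ∈ B.toFinset, ε / (L : ℝ) ^ 2 := by
    rw [Finset.sum_const, Set.ncard_eq_toFinset_card', nsmul_eq_mul]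
  rw [h1]
  refine (Finset.sum_le_sum fun v hv => ?_).trans
    (Finset.sum_le_sum_of_subset_of_nonneg (Finset.subset_univ _) fun v _ _ => by positivity)
  rw [le_div_iff₀ hd]
  refine le_trans (le_of_eq ?_) (hs.big v (by simpa using hv)).le
  ring

lemma IsSkeleton.sum_layerLoss_le (hs : IsSkeleton ε δ γ L d H B T S X) (hε : 0 < ε)
    (hδ : 0 < δ) (hL : 2 ≤ L) (hd : 0 < d) (hh1 : h ≤ 1) :
    ∑ v, layerLoss (h / (lam L d * (L : ℝ) ^ 4)) X S v ≤
      12 * δ * ((L : ℝ) ^ 2 / ε) * ∑ v, (deg H v : ℝ) / d := by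
  have hL1 : (2 : ℝ) ≤ L := by exact_mod_cast hL
  have hl := half_lt_lam (L := L) (by omega) hd
  have hr : 0 < lam L d * (L : ℝ) ^ 4 := by positivity
  have hr2 : 2 ≤ lam L d * (L : ℝ) ^ 4 := by
    have : (2 : ℝ) ^ 4 ≤ (L : ℝ) ^ 4 := by gcongr
    nlinarith
  -- The degree is at most `λ L ^ 4 + 2`, and `λ L ^ 4 ≥ 2`, so the ratio is at most 2. A spurious
  -- node thus costs at most 3, and `3 * 4 = 12`.
  have hD : ∀ v, deg X v * (h / (lam L d * (L : ℝ) ^ 4)) ≤ 2 := by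
    intro v
    rw [mul_div_assoc', div_le_iff₀ hr]
    have := hs.max_deg v
    have h0 : (0 : ℝ) ≤ deg X v := Nat.cast_nonneg _
    nlinarith
  refine (SkeletonMatching.sum_layerLoss_le X hD).trans ?_
  have h1 := hs.spurious
  have h2 := hs.ncard_big_mul_le hd
  have h3 : (B.ncard : ℝ) ≤ (L : ℝ) ^ 2 / ε * ∑ v, (deg H v : ℝ) / d := by
    calc (B.ncard : ℝ) = (L : ℝ) ^ 2 / ε * (B.ncard * (ε / (L : ℝ) ^ 2)) := by field_simp
      _ ≤ _ := by gcongr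
  calc (S.ncard : ℝ) * (1 + 2) ≤ 4 * δ * ((L : ℝ) ^ 2 / ε * ∑ v, (deg H v : ℝ) / d) * 3 := by
        nlinarith
    _ = _ := by ring

end Skeleton

/-! ### Edge weights of the partition, split by level. -/

section Partition

variable [Fintype V] {G : SimpleGraph V} {α β : ℝ} {lev : V → ℤ}

open Classical in
lemma nodeWeight_eq_sum (v : V) : nodeWeight G α β lev v =
    ∑ u, if G.Adj v u then 1 / degThreshold α β (max (lev v) (lev u)) else 0 := by
  rw [nodeWeight, ← Finset.sum_filter, finsum_mem_eq_sum_of_inter_support_eq]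
  ext; simp

open Classical in
lemma sum_deg_levelGraph_div (J : Finset ℤ) (v : V) :
    ∑ i ∈ J, (deg (levelGraph G lev i) v : ℝ) / degThreshold α β i =
      ∑ u, if G.Adj v u ∧ max (lev v) (lev u) ∈ J
        then 1 / degThreshold α β (max (lev v) (lev u)) else 0 := by
  simp_rw [div_eq_mul_one_div (deg _ v : ℝ), deg_mul_eq_sum]
  rw [Finset.sum_comm]
  refine Finset.sum_congr rfl fun u _ => ?_
  by_cases h : G.Adj v u
  · simp [levelGraph, h]
  · simp [levelGraph, h]

lemma sum_deg_levelGraph_div_le (hα : 0 < α) (hβ : 0 < β) (J : Finset ℤ) (v : V) :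
    ∑ i ∈ J, (deg (levelGraph G lev i) v : ℝ) / degThreshold α β i ≤ nodeWeight G α β lev v := by
  classical
  rw [sum_deg_levelGraph_div, nodeWeight_eq_sum]
  refine Finset.sum_le_sum fun u _ => ?_
  have := degThreshold_pos hα hβ (max (lev v) (lev u))
  split_ifs with h1 h2 <;> first | exact le_rfl | exact absurd h1.1 h2 | positivity

lemma sum_deg_levelGraph_div_eq {J : Finset ℤ} {v : V}
    (hJ : ∀ u, G.Adj v u → max (lev v) (lev u) ∈ J) :
    ∑ i ∈ J, (deg (levelGraph G lev i) v : ℝ) / degThreshold α β i = nodeWeight G α β lev v := by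
  classical
  rw [sum_deg_levelGraph_div, nodeWeight_eq_sum]
  refine Finset.sum_congr rfl fun u _ => ?_
  by_cases h : G.Adj v u
  · simp [h, hJ u h]
  · simp [h]

/-- The weights `1 / d_i` themselves form a fractional matching of `G`. -/
lemma IsPartition.sum_nodeWeight_le (hp : IsPartition G α β lev) (hα : 0 < α) (hβ : 0 < β) :
    ∑ v, nodeWeight G α β lev v ≤ 3 * maxMatching G := by
  classical
  have h := fun v => hp.weight_le v
  simp_rw [nodeWeight_eq_sum] at h ⊢
  refine sum_le_three_mul_maxMatching G (fun u v => ?_) (fun u v => ?_) (fun u v huv => ?_) h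
  · have := degThreshold_pos hα hβ (max (lev u) (lev v))
    split_ifs <;> positivity
  · rw [G.adj_comm, max_comm]
  · by_contra hn
    simp [hn] at huv

end Partition

/-! ### Augmenting small weights along a matching. -/

/-- If a nonnegative node function has sum at least `a` over both endpoints of every matching edge,
its total is at least `a` times the size of the matching. -/
lemma mul_ncard_edgeSet_le_sum [Fintype V] {G : SimpleGraph V} {M : G.Subgraph}
    (hM : M.IsMatching) {q : V → ℝ} {a : ℝ} (hq : ∀ v, 0 ≤ q v)
    (ha : ∀ u v, M.Adj u v → a ≤ q u + q v) : a * M.edgeSet.ncard ≤ ∑ v, q v := by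
  classical
  have hone : ∀ v (c : ℝ), (∑ u, if M.Adj v u then c else 0) = if v ∈ M.verts then c else 0 := by
    intro v c
    split_ifs with hv
    · obtain ⟨w, hw, hu⟩ := hM hv
      rw [Finset.sum_eq_single w (fun x _ hx => if_neg fun h => hx (hu x h)) (by simp), if_pos hw]
    · exact Finset.sum_eq_zero fun u _ => if_neg fun h => hv h.fst_mem
  have h1 : ∑ v, ∑ u, (if M.Adj v u then a else 0) = 2 * (a * M.edgeSet.ncard) := by
    simp_rw [hone]
    have hc : M.verts.ncard = (Finset.univ.filter (· ∈ M.verts)).card := by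
      rw [Set.ncard_eq_toFinset_card']
      congr 1
      ext; simp
    rw [← Finset.sum_filter, Finset.sum_const, nsmul_eq_mul, ← hc, ncard_verts_eq_two_mul hM]
    push_cast
    ring
  have h2 : ∑ v, ∑ u, (if M.Adj v u then q v else 0) ≤ ∑ v, q v := by
    simp_rw [hone]
    refine Finset.sum_le_sum fun v _ => ?_
    split_ifs
    · exact le_rfl
    · exact hq v
  have h3 : ∑ v, ∑ u, (if M.Adj v u then q u else 0) =
      ∑ v, ∑ u, (if M.Adj v u then q v else 0) := by
    rw [Finset.sum_comm]
    simp_rw [M.adj_comm]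
  have h4 : ∑ v, ∑ u, (if M.Adj v u then a else 0) ≤
      ∑ v, ∑ u, (if M.Adj v u then q v else 0) + ∑ v, ∑ u, (if M.Adj v u then q u else 0) := by
    simp_rw [← Finset.sum_add_distrib]
    refine Finset.sum_le_sum fun v _ => Finset.sum_le_sum fun u _ => ?_
    split_ifs with h
    · exact ha v u h
    · simp
  linarith

/-- Augmenting small edge weights `x` by the edges of a matching `M` that lie in `Y`: if, up to a
small `loss`, every other edge of `M` has an endpoint to which `x` gives weight at least `a`, then
`M` is not much larger than a maximum matching in any graph containing `Y` and the support of
`x`. -/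
theorem mul_ncard_edgeSet_le_of_weights [Fintype V] {G H Y : SimpleGraph V} {M : G.Subgraph}
    (hM : M.IsMatching) (hYH : Y ≤ H) {x : V → V → ℝ} {loss : V → ℝ} {ε a : ℝ}
    (hε : 0 < ε) (hε1 : ε ≤ 1) (ha : a ≤ 1)
    (hx0 : ∀ u v, 0 ≤ x u v) (hxsymm : ∀ u v, x u v = x v u)
    (hxsupp : ∀ u v, x u v ≠ 0 → H.Adj u v) (hxle : ∀ u v, x u v ≤ ε ^ 2 / 8)
    (hrow : ∀ v, ∑ u, x v u ≤ 1) (hloss : ∀ v, 0 ≤ loss v)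
    (hcov : ∀ u v, M.Adj u v → ¬ Y.Adj u v →
      a ≤ ∑ w, x u w + loss u ∨ a ≤ ∑ w, x v w + loss v) :
    a * M.edgeSet.ncard ≤ 2 * (1 + ε) * maxMatching H + ∑ v, loss v := by
  classical
  -- The slack left by `x` at the fuller endpoint: adding it keeps both endpoints feasible and
  -- brings that one to total weight 1, which is at least `a`.
  let y : V → V → ℝ := fun u v =>
    if M.Adj u v ∧ Y.Adj u v then 1 - max (∑ w, x u w) (∑ w, x v w) else 0
  have hy0 : ∀ u v, 0 ≤ y u v := by
    intro u v
    simp only [y]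
    split_ifs
    · exact sub_nonneg.mpr (max_le (hrow u) (hrow v))
    · exact le_rfl
  have hysymm : ∀ u v, y u v = y v u := by
    intro u v
    simp only [y, M.adj_comm u v, Y.adj_comm u v, max_comm (∑ w, x u w)]
  let P : H.Subgraph :=
    { verts := {v | ∃ w, M.Adj v w ∧ Y.Adj v w}
      Adj := fun u v => M.Adj u v ∧ Y.Adj u v
      adj_sub := fun h => hYH h.2
      edge_vert := fun {v w} h => ⟨w, h⟩
      symm := ⟨fun _ _ h => ⟨h.1.symm, h.2.symm⟩⟩ }
  have hP : P.IsMatching := by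
    rintro v ⟨w, hw⟩
    exact ⟨w, hw, fun z hz => hM.eq_of_adj_left hz.1 hw.1⟩
  have hyrow : ∀ v, ∑ u, y v u ≤ 1 - ∑ u, x v u := by
    intro v
    by_cases h : ∃ w, M.Adj v w
    · obtain ⟨w, hw⟩ := h
      rw [Finset.sum_eq_single w
        (fun z _ hz => if_neg fun h => hz (hM.eq_of_adj_left h.1 hw)) (by simp)]
      split_ifs
      · exact sub_le_sub_left (le_max_left _ _) _
      · exact sub_nonneg.mpr (hrow v)
    · push Not at h
      rw [Finset.sum_eq_zero fun u _ => if_neg fun hu => h u hu.1]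
      exact sub_nonneg.mpr (hrow v)
  have hmain := sum_add_le_mul_maxMatching H hε hε1 hx0 hy0 hxsymm hysymm hxsupp hxle hP
    (fun u v h => by by_contra hn; exact h (if_neg hn))
    (fun v => by rw [Finset.sum_add_distrib]; linarith [hyrow v])
  have hq := mul_ncard_edgeSet_le_sum hM (a := a)
    (q := fun v => ∑ u, (x v u + y v u) + loss v)
    (fun v => add_nonneg (Finset.sum_nonneg fun u _ => add_nonneg (hx0 v u) (hy0 v u)) (hloss v))
    (fun u v huv => ?_)
  · rw [Finset.sum_add_distrib] at hq
    linarith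
  simp only [Finset.sum_add_distrib]
  have hs : ∀ v, 0 ≤ ∑ u, x v u := fun v => Finset.sum_nonneg fun u _ => hx0 v u
  have ht : ∀ v, 0 ≤ ∑ u, y v u := fun v => Finset.sum_nonneg fun u _ => hy0 v u
  by_cases hY : Y.Adj u v
  · have h1 : y u v ≤ ∑ w, y u w :=
      Finset.single_le_sum (fun w _ => hy0 u w) (Finset.mem_univ v)
    have h2 : y v u ≤ ∑ w, y v w :=
      Finset.single_le_sum (fun w _ => hy0 v w) (Finset.mem_univ u)
    have h3 : y u v = 1 - max (∑ w, x u w) (∑ w, x v w) := if_pos ⟨huv, hY⟩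
    rw [hysymm] at h2
    have h4 := hrow u
    have h5 := hrow v
    rcases max_cases (∑ w, x u w) (∑ w, x v w) with h | h <;>
      linarith [hloss u, hloss v, hs u, hs v, h.1]
  · rcases hcov u v huv hY with h | h <;>
      linarith [hs u, hs v, ht u, ht v, hloss u, hloss v]

/-! ### The cutoff level and the degree bound. -/

lemma three_le_of_four_div_le {ε : ℝ} {L : ℤ} (hε : 0 < ε) (hε1 : ε < 1) (hL : 1 ≤ L)
    (h : 4 / ε ≤ (L : ℝ) ^ 2) : 3 ≤ L := by
  rw [div_le_iff₀ hε] at h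
  by_contra hlt
  have h1 : (L : ℝ) ≤ 2 := by exact_mod_cast (by omega : L ≤ 2)
  have h2 : (1 : ℝ) ≤ L := by exact_mod_cast hL
  have h3 : (L : ℝ) ^ 2 ≤ 4 := by nlinarith
  nlinarith

/-- Here `α * β < 8` while `2 * L ^ 4 ≥ 162`. The bound limits the sparsified levels to at most `L`
and keeps level `-1` out of them. -/
lemma one_le_cutLevel {ε : ℝ} {L : ℤ} (hε : 0 < ε) (hε1 : ε < 1) (hL : 3 ≤ L) :
    1 ≤ cutLevel (1 + 3 * ε) (1 + ε) L := by
  have hL' : (3 : ℝ) ≤ L := by exact_mod_cast hL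
  have h4 : (3 : ℝ) ^ 4 ≤ (L : ℝ) ^ 4 := by gcongr
  have : 0 < cutLevel (1 + 3 * ε) (1 + ε) L := by
    refine Int.ceil_pos.mpr (Real.logb_pos (by linarith) ?_)
    rw [lt_div_iff₀ (by positivity)]
    nlinarith
  omega

lemma degThreshold_cutLevel_sub_one_le {α β : ℝ} {L : ℤ} (hα : 0 < α) (hβ : 1 < β) (hL : 1 ≤ L) :
    degThreshold α β (cutLevel α β L - 1) ≤ 2 * (L : ℝ) ^ 4 := by
  have hL' : (1 : ℝ) ≤ L := by exact_mod_cast hL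
  have := Int.ceil_lt_add_one (Real.logb β (2 * (L : ℝ) ^ 4 / (α * β)))
  have h2 : ((cutLevel α β L - 1 : ℤ) : ℝ) < Real.logb β (2 * (L : ℝ) ^ 4 / (α * β)) := by
    unfold cutLevel; push_cast; linarith
  rw [Real.lt_logb_iff_rpow_lt hβ (by positivity), Real.rpow_intCast,
    lt_div_iff₀ (by positivity)] at h2
  exact h2.le

/-- Each edge of level below `L'` weighs at least `1 / d_{L'-1}`, and the total weight at `v` is at
most 1. -/
lemma deg_low_levels_le [Fintype V] {G : SimpleGraph V} {α β : ℝ} {lev : V → ℤ} {L' : ℤ}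
    (hp : IsPartition G α β lev) (hα : 0 < α) (hβ : 1 ≤ β) (v : V) :
    (deg (⨆ i ∈ Set.Ico 0 L', levelGraph G lev i) v : ℝ) ≤ degThreshold α β (L' - 1) := by
  classical
  have hd := degThreshold_pos hα (by linarith : 0 < β) (L' - 1)
  rw [← div_le_one hd]
  refine le_trans ?_ (hp.weight_le v)
  rw [div_eq_mul_one_div, deg_mul_eq_sum, nodeWeight_eq_sum]
  refine Finset.sum_le_sum fun u _ => ?_
  have hm := degThreshold_pos hα (by linarith : 0 < β) (max (lev v) (lev u))
  split_ifs with h1 h2 h2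
  · refine one_div_le_one_div_of_le hm ?_
    simp only [iSup_adj, levelGraph, Set.mem_Ico] at h1
    obtain ⟨i, hi, -, h⟩ := h1
    rw [h]
    unfold degThreshold
    gcongr
    omega
  · simp only [iSup_adj, levelGraph] at h1
    obtain ⟨i, hi, h, -⟩ := h1
    exact absurd h h2
  · positivity
  · exact le_rfl

lemma deg_sup_le [Finite V] (H H' : SimpleGraph V) (v : V) :
    deg (H ⊔ H') v ≤ deg H v + deg H' v := by
  have : (H ⊔ H').neighborSet v = H.neighborSet v ∪ H'.neighborSet v := by ext; simp
  rw [deg, this]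
  exact Set.ncard_union_le _ _

lemma deg_iSup_le_sum [Fintype V] (J : Finset ℤ) (X : ℤ → SimpleGraph V) (v : V) :
    (deg (⨆ i ∈ J, X i) v : ℝ) ≤ ∑ i ∈ J, (deg (X i) v : ℝ) := by
  classical
  simp_rw [deg_eq_sum]
  rw [Finset.sum_comm]
  refine Finset.sum_le_sum fun u _ => ?_
  split_ifs with h
  · simp only [iSup_adj] at h
    obtain ⟨i, hi, h⟩ := h
    refine le_trans (le_of_eq (if_pos h).symm) (Finset.single_le_sum
      (f := fun i => if (X i).Adj v u then (1 : ℝ) else 0) (fun j _ => ?_) hi)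
    split_ifs <;> simp
  · refine Finset.sum_nonneg fun j _ => ?_
    split_ifs <;> simp

lemma card_Icc_le {L L' : ℤ} (hL : 1 ≤ L) (hL' : 1 ≤ L') :
    ((Finset.Icc L' L).card : ℝ) ≤ L := by
  have : ((Finset.Icc L' L).card : ℤ) ≤ L := by rw [Int.card_Icc]; omega
  exact_mod_cast this

/-- The degree bound for the union of the sparsified levels. -/
lemma deg_iSup_skeletons_le [Fintype V] {G : SimpleGraph V} {ε δ γ α β : ℝ} {L L' : ℤ}
    {lev : V → ℤ} {B T S : ℤ → Set V} {X : ℤ → SimpleGraph V}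
    (hα : 0 < α) (hβ : 0 < β) (hL : 1 ≤ L) (hL' : 1 ≤ L')
    (hs : ∀ i ∈ Finset.Icc L' L,
      IsSkeleton ε δ γ L (degThreshold α β i) (levelGraph G lev i) (B i) (T i) (S i) (X i))
    (v : V) : (deg (⨆ i ∈ Finset.Icc L' L, X i) v : ℝ) ≤ 3 * (L : ℝ) ^ 5 := by
  have hL1 : (1 : ℝ) ≤ L := by exact_mod_cast hL
  have h4 : (1 : ℝ) ≤ (L : ℝ) ^ 4 := one_le_pow₀ hL1
  refine (deg_iSup_le_sum _ X v).trans ?_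
  have h1 : ∀ i ∈ Finset.Icc L' L, (deg (X i) v : ℝ) ≤ 3 * (L : ℝ) ^ 4 := by
    intro i hi
    have h1 := (hs i hi).max_deg v
    have h2 := lam_le_one hL (degThreshold_pos hα hβ i)
    nlinarith
  refine (Finset.sum_le_sum h1).trans ?_
  rw [Finset.sum_const, nsmul_eq_mul]
  calc _ ≤ (L : ℝ) * (3 * (L : ℝ) ^ 4) := by gcongr; exact card_Icc_le hL hL'
    _ = _ := by ring

/-! ### The constants `h₀` and `h₁`. -/

lemma h₀_nonneg {ε γ : ℝ} (hε : 0 < ε) : 0 ≤ h₀ ε γ := by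
  unfold h₀; positivity

lemma h₀_le_one {ε γ : ℝ} (hε : 0 < ε) (hγ : 0 < γ) : h₀ ε γ ≤ 1 :=
  mul_le_one₀ (by simpa using hγ.le) (by positivity) (inv_le_one_of_one_le₀ (by linarith))

/-- This is what `h₀` is chosen for: it absorbs the overshoot `exp γ` at big nodes and a total error
`4 * ε` from tiny nodes. -/
lemma h₀_mul_le_one {ε γ : ℝ} (hε : 0 < ε) (hγ : 0 < γ) :
    h₀ ε γ * (Real.exp γ + 4 * ε) ≤ 1 := by
  have he : Real.exp (-γ) ≤ 1 := by simpa using hγ.le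
  have hee : Real.exp (-γ) * Real.exp γ = 1 := by rw [← Real.exp_add]; simp
  have : h₀ ε γ * (Real.exp γ + 4 * ε) =
      (Real.exp (-γ) * Real.exp γ + Real.exp (-γ) * (4 * ε)) / (1 + 4 * ε) := by
    unfold h₀; ring
  rw [this, hee, div_le_one (by positivity)]
  nlinarith

lemma h₁_le_one {α β ε γ : ℝ} (hε : 0 < ε) (hγ : 0 < γ) (hα : 1 ≤ α) (hβ : 1 ≤ β) :
    h₁ α β ε γ ≤ 1 := by
  have he : Real.exp (-γ) ≤ 1 := by simpa using hγ.le
  have h1 : h₀ ε γ * Real.exp (-γ) ≤ 1 := mul_le_one₀ (h₀_le_one hε hγ) (Real.exp_pos _).le he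
  have h2 : 0 ≤ h₀ ε γ * Real.exp (-γ) := mul_nonneg (h₀_nonneg hε) (Real.exp_pos _).le
  have h3 : (α * β)⁻¹ ≤ 1 := inv_le_one_of_one_le₀ (one_le_mul_of_one_le_of_one_le hα hβ)
  unfold h₁
  nlinarith

/-! ### Weights and losses over all sparsified levels. -/

/-- The fractional weights on the union of the sparsified levels. -/
noncomputable def skeletonWeight (h : ℝ) (α β : ℝ) (L L' : ℤ) (X : ℤ → SimpleGraph V)
    (S : ℤ → Set V) (u v : V) : ℝ :=
  ∑ i ∈ Finset.Icc L' L,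
    layerWeight (h / (lam L (degThreshold α β i) * (L : ℝ) ^ 4)) (X i) (S i) u v

/-- The loss caused by spurious nodes, summed over the sparsified levels. -/
noncomputable def skeletonLoss [Fintype V] (h : ℝ) (α β : ℝ) (L L' : ℤ) (X : ℤ → SimpleGraph V)
    (S : ℤ → Set V) (v : V) : ℝ :=
  ∑ i ∈ Finset.Icc L' L,
    layerLoss (h / (lam L (degThreshold α β i) * (L : ℝ) ^ 4)) (X i) (S i) v

section

variable {G : SimpleGraph V} {h ε δ γ α β : ℝ} {L L' : ℤ} {lev : V → ℤ}
  {B T S : ℤ → Set V} {X : ℤ → SimpleGraph V}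

lemma layerCoeff_nonneg (hh : 0 ≤ h) (hα : 0 < α) (hβ : 0 < β) (hL : 1 ≤ L) (i : ℤ) :
    0 ≤ h / (lam L (degThreshold α β i) * (L : ℝ) ^ 4) := by
  have := lam_pos hL (degThreshold_pos hα hβ i)
  have : (1 : ℝ) ≤ L := by exact_mod_cast hL
  positivity

lemma skeletonWeight_nonneg (hh : 0 ≤ h) (hα : 0 < α) (hβ : 0 < β) (hL : 1 ≤ L) (u v : V) :
    0 ≤ skeletonWeight h α β L L' X S u v :=
  Finset.sum_nonneg fun i _ => layerWeight_nonneg (layerCoeff_nonneg hh hα hβ hL i) _ _ _ _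

lemma skeletonWeight_comm (u v : V) :
    skeletonWeight h α β L L' X S u v = skeletonWeight h α β L L' X S v u :=
  Finset.sum_congr rfl fun _ _ => layerWeight_comm _ _ _ _ _

lemma adj_of_skeletonWeight_ne_zero {u v : V} (hne : skeletonWeight h α β L L' X S u v ≠ 0) :
    ∃ i ∈ Finset.Icc L' L, (X i).Adj u v := by
  obtain ⟨i, hi, hx⟩ := Finset.exists_ne_zero_of_sum_ne_zero hne
  refine ⟨i, hi, ?_⟩
  by_contra hn
  exact hx (if_neg fun h => hn h.1)

/-- An edge has only one level, so at most one summand is nonzero; the factor 2 comes from `λ >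
1/2`. -/
lemma skeletonWeight_le (hh1 : h ≤ 1) (hα : 0 < α) (hβ : 0 < β) (hL : 1 ≤ L)
    (hX : ∀ i ∈ Finset.Icc L' L, X i ≤ levelGraph G lev i) (u v : V) :
    skeletonWeight h α β L L' X S u v ≤ 2 / (L : ℝ) ^ 4 := by
  classical
  have hL1 : (1 : ℝ) ≤ L := by exact_mod_cast hL
  have h1 : ∀ i ∈ Finset.Icc L' L,
      layerWeight (h / (lam L (degThreshold α β i) * (L : ℝ) ^ 4)) (X i) (S i) u v ≤
        if max (lev u) (lev v) = i then 2 / (L : ℝ) ^ 4 else 0 := by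
    intro i hi
    have hl := half_lt_lam hL (degThreshold_pos hα hβ i)
    unfold layerWeight
    split_ifs with ha hb hb
    · rw [div_le_div_iff₀ (by positivity) (by positivity)]
      have : (0 : ℝ) < (L : ℝ) ^ 4 := by positivity
      nlinarith
    · exact absurd (hX i hi ha.1).2 hb
    · positivity
    · exact le_rfl
  refine (Finset.sum_le_sum h1).trans ?_
  rw [Finset.sum_ite_eq]
  split_ifs
  · exact le_rfl
  · positivity

variable [Fintype V]

lemma skeletonLoss_nonneg (hh : 0 ≤ h) (hα : 0 < α) (hβ : 0 < β) (hL : 1 ≤ L) (v : V) :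
    0 ≤ skeletonLoss h α β L L' X S v :=
  Finset.sum_nonneg fun i _ => layerLoss_nonneg (layerCoeff_nonneg hh hα hβ hL i) _ _ _

lemma sum_skeletonWeight (v : V) : ∑ u, skeletonWeight h α β L L' X S v u =
    ∑ i ∈ Finset.Icc L' L,
      ∑ u, layerWeight (h / (lam L (degThreshold α β i) * (L : ℝ) ^ 4)) (X i) (S i) v u :=
  Finset.sum_comm

lemma sum_skeletonWeight_le_one (hp : IsPartition G α β lev)
    (hs : ∀ i ∈ Finset.Icc L' L,
      IsSkeleton ε δ γ L (degThreshold α β i) (levelGraph G lev i) (B i) (T i) (S i) (X i))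
    (hε : 0 < ε) (hγ : 0 < γ) (hα : 0 < α) (hβ : 0 < β) (hL : 3 ≤ L) (hL' : 1 ≤ L')
    (hLε : 4 / ε ≤ (L : ℝ) ^ 2) (v : V) :
    ∑ u, skeletonWeight (h₀ ε γ) α β L L' X S v u ≤ 1 := by
  have hL3 : (3 : ℝ) ≤ L := by exact_mod_cast hL
  have hcard := card_Icc_le (by omega : 1 ≤ L) hL'
  have hh := h₀_nonneg (γ := γ) hε
  rw [sum_skeletonWeight]
  refine (Finset.sum_le_sum fun i hi => (hs i hi).sum_layerWeight_le hε (by omega)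
    (degThreshold_pos hα hβ i) hh v).trans ?_
  rw [← Finset.mul_sum, Finset.sum_add_distrib, ← Finset.mul_sum, Finset.sum_const, nsmul_eq_mul]
  refine le_trans ?_ (h₀_mul_le_one hε hγ)
  refine mul_le_mul_of_nonneg_left (add_le_add ?_ ?_) hh
  · have := (sum_deg_levelGraph_div_le (G := G) (lev := lev) hα hβ (Finset.Icc L' L) v).trans
      (hp.weight_le v)
    nlinarith [Real.exp_pos γ]
  · have hε4 : 4 ≤ ε * (L : ℝ) ^ 2 := by rwa [div_le_iff₀' hε] at hLε
    calc _ ≤ (L : ℝ) * (3 * ε / (L : ℝ) ^ 2 + 4 / (L : ℝ) ^ 4) := by gcongr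
      _ = (3 * ε * (L : ℝ) ^ 2 + 4) / (L : ℝ) ^ 3 := by field_simp
      _ ≤ 4 * ε := by
        rw [div_le_iff₀ (by positivity)]
        have : 0 ≤ ε * (L : ℝ) ^ 2 * (L - 3) := by
          have : 0 ≤ (L : ℝ) - 3 := by linarith
          positivity
        nlinarith

/-- All edges at a node of level at least `L'` lie in the sparsified levels, so the full weight, at
least `1 / (α * β)`, is seen there. -/
lemma h₁_le_sum_skeletonWeight_add_skeletonLoss (hp : IsPartition G α β lev)
    (hs : ∀ i ∈ Finset.Icc L' L,
      IsSkeleton ε δ γ L (degThreshold α β i) (levelGraph G lev i) (B i) (T i) (S i) (X i))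
    (hε : 0 < ε) (hγ : 0 < γ) (hα : 0 < α) (hβ : 0 < β) (hL : 1 ≤ L) (hL' : 1 ≤ L')
    (hLtop : L = topLevel α β (Fintype.card V)) {v : V} (hv : L' ≤ lev v) :
    h₁ α β ε γ ≤ ∑ u, skeletonWeight (h₀ ε γ) α β L L' X S v u +
      skeletonLoss (h₀ ε γ) α β L L' X S v := by
  have hL1 : (1 : ℝ) ≤ L := by exact_mod_cast hL
  have hcard := card_Icc_le hL hL'
  have hh := h₀_nonneg (γ := γ) hε
  have hhe : 0 ≤ h₀ ε γ * Real.exp (-γ) := mul_nonneg hh (Real.exp_pos _).le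
  rw [sum_skeletonWeight, skeletonLoss, ← Finset.sum_add_distrib]
  refine le_trans ?_ (Finset.sum_le_sum fun i hi =>
    (hs i hi).le_sum_layerWeight_add_layerLoss hε hγ hL (degThreshold_pos hα hβ i) hh
      (h₀_le_one hε hγ) v)
  rw [← Finset.mul_sum, Finset.sum_sub_distrib, Finset.sum_const, nsmul_eq_mul, h₁,
    sum_deg_levelGraph_div_eq (J := Finset.Icc L' L) fun u _ => Finset.mem_Icc.mpr
      ⟨hv.trans (le_max_left _ _),
        max_le (hLtop ▸ hp.le_top v) (hLtop ▸ hp.le_top u)⟩]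
  refine mul_le_mul_of_nonneg_left (sub_le_sub ?_ ?_) hhe
  · rw [← one_div]
    exact hp.le_weight v (by omega)
  · calc _ ≤ (L : ℝ) * (3 * ε / (L : ℝ) ^ 2) := by gcongr
      _ = 3 * ε / L := by field_simp
      _ ≤ 3 * ε := div_le_self (by positivity) hL1

lemma sum_skeletonLoss_le (hp : IsPartition G α β lev)
    (hs : ∀ i ∈ Finset.Icc L' L,
      IsSkeleton ε δ γ L (degThreshold α β i) (levelGraph G lev i) (B i) (T i) (S i) (X i))
    (hε : 0 < ε) (hδ : 0 < δ) (hγ : 0 < γ) (hα : 0 < α) (hβ : 0 < β) (hL : 2 ≤ L)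
    (hLε : 4 / ε ≤ (L : ℝ) ^ 2) (ht : 0 < 1 - 32 * δ * (L : ℝ) ^ 4 / ε ^ 2) :
    ∑ v, skeletonLoss (h₀ ε γ) α β L L' X S v ≤ ε * maxMatching G := by
  have hL2 : (2 : ℝ) ≤ L := by exact_mod_cast hL
  unfold skeletonLoss
  rw [Finset.sum_comm]
  refine (Finset.sum_le_sum fun i hi => (hs i hi).sum_layerLoss_le hε hδ hL
    (degThreshold_pos hα hβ i) (h₀_le_one hε hγ)).trans ?_
  rw [← Finset.mul_sum, Finset.sum_comm]
  have h1 := (Finset.sum_le_sum fun v _ =>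
    sum_deg_levelGraph_div_le (G := G) (lev := lev) hα hβ (Finset.Icc L' L) v).trans
      (hp.sum_nodeWeight_le hα hβ)
  -- Since `L ^ 2 ≥ 4`, we get `36 * δ * L ^ 2 ≤ 9 * δ * L ^ 4`, which is below `ε ^ 2` by `ht`.
  have h2 : 12 * δ * ((L : ℝ) ^ 2 / ε) * 3 ≤ ε := by
    have hε4 : 4 ≤ ε * (L : ℝ) ^ 2 := by rwa [div_le_iff₀' hε] at hLε
    have h3 : 32 * δ * (L : ℝ) ^ 4 < ε ^ 2 := by
      rw [sub_pos, div_lt_one (by positivity)] at ht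
      exact ht
    rw [mul_div_assoc', div_mul_eq_mul_div, div_le_iff₀ hε]
    have h4 : (4 : ℝ) ≤ (L : ℝ) ^ 2 := by nlinarith
    have h5 : 0 ≤ δ * (L : ℝ) ^ 2 * ((L : ℝ) ^ 2 - 4) := by
      have : 0 ≤ (L : ℝ) ^ 2 - 4 := by linarith
      positivity
    have h6 : 0 ≤ δ * (L : ℝ) ^ 2 := by positivity
    nlinarith
  calc _ ≤ 12 * δ * ((L : ℝ) ^ 2 / ε) * (3 * maxMatching G) :=
        mul_le_mul_of_nonneg_left h1 (by positivity)
    _ = 12 * δ * ((L : ℝ) ^ 2 / ε) * 3 * maxMatching G := by ring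
    _ ≤ _ := by gcongr

end

/-! ### Assembling the approximation and degree bounds. -/

/-- The sparsified graph preserves the maximum matching size up to a constant factor. -/
theorem h₁_sub_mul_maxMatching_le [Fintype V] {G XY : SimpleGraph V} {ε δ γ α β : ℝ} {L L' : ℤ}
    {lev : V → ℤ} {B T S : ℤ → Set V} {X : ℤ → SimpleGraph V} (hp : IsPartition G α β lev)
    (hs : ∀ i ∈ Finset.Icc L' L,
      IsSkeleton ε δ γ L (degThreshold α β i) (levelGraph G lev i) (B i) (T i) (S i) (X i))
    (hXY : XY = (⨆ i ∈ Finset.Icc L' L, X i) ⊔ (⨆ i ∈ Set.Ico 0 L', levelGraph G lev i))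
    (hε : 0 < ε) (hε1 : ε < 1) (hδ : 0 < δ) (hγ : 0 < γ) (hα : 1 ≤ α) (hβ : 1 ≤ β) (hL : 3 ≤ L)
    (hL' : 1 ≤ L') (hLtop : L = topLevel α β (Fintype.card V))
    (hLε : 4 / ε ≤ (L : ℝ) ^ 2) (ht : 0 < 1 - 32 * δ * (L : ℝ) ^ 4 / ε ^ 2) :
    (h₁ α β ε γ - ε) * maxMatching G ≤ 2 * (1 + ε) * maxMatching XY := by
  have hα0 : 0 < α := by linarith
  have hβ0 : 0 < β := by linarith
  have hL1 : 1 ≤ L := by omega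
  have hL3 : (3 : ℝ) ≤ L := by exact_mod_cast hL
  have hh := h₀_nonneg (γ := γ) hε
  obtain ⟨M, hM, hc⟩ := exists_isMatching_ncard_eq_maxMatching G
  have hloss := sum_skeletonLoss_le (L' := L') hp hs hε hδ hγ hα0 hβ0 (by omega) hLε ht
  have hε4 : 4 ≤ ε * (L : ℝ) ^ 2 := by rwa [div_le_iff₀' hε] at hLε
  have hmain := mul_ncard_edgeSet_le_of_weights (H := XY)
    (Y := ⨆ i ∈ Set.Ico 0 L', levelGraph G lev i)
    (x := skeletonWeight (h₀ ε γ) α β L L' X S) (loss := skeletonLoss (h₀ ε γ) α β L L' X S)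
    hM (hXY ▸ le_sup_right) hε hε1.le (h₁_le_one hε hγ hα hβ)
    (skeletonWeight_nonneg hh hα0 hβ0 hL1) skeletonWeight_comm
    (fun u v huv => ?_) (fun u v => ?_)
    (sum_skeletonWeight_le_one hp hs hε hγ hα0 hβ0 hL hL' hLε)
    (skeletonLoss_nonneg hh hα0 hβ0 hL1) (fun u v huv hY => ?_)
  · rw [hc] at hmain
    linarith
  · obtain ⟨i, hi, hadj⟩ := adj_of_skeletonWeight_ne_zero huv
    rw [hXY]
    refine Or.inl ?_
    simp only [iSup_adj]
    exact ⟨i, hi, hadj⟩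
  · refine (skeletonWeight_le (h₀_le_one hε hγ) hα0 hβ0 hL1
      (fun i hi => (hs i hi).subgraph) u v).trans ?_
    -- `2 / L ^ 4 ≤ ε ^ 2 / 8` is the square of `4 ≤ ε * L ^ 2`.
    rw [div_le_iff₀ (by positivity)]
    nlinarith
  -- A matching edge outside `Y` has level at least `L'`, hence so does one of its endpoints.
  · have hlow : L' ≤ max (lev u) (lev v) := by
      by_contra hlt
      apply hY
      simp only [iSup_adj]
      exact ⟨_, ⟨hp.edge_level_nonneg u v (M.adj_sub huv), not_le.mp hlt⟩, M.adj_sub huv, rfl⟩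
    exact (le_max_iff.mp hlow).imp
      (h₁_le_sum_skeletonWeight_add_skeletonLoss hp hs hε hγ hα0 hβ0 hL1 hL' hLtop)
      (h₁_le_sum_skeletonWeight_add_skeletonLoss hp hs hε hγ hα0 hβ0 hL1 hL' hLtop)

end SkeletonMatching

theorem mainTheorem2 :
    ∃ C : ℝ, 0 < C ∧
      ∀ (V : Type*) [Fintype V] (G : SimpleGraph V)
        (ε δ γ α β : ℝ) (K : ℕ) (L L' : ℤ)
        (lev : V → ℤ) (B T S : ℤ → Set V) (X : ℤ → SimpleGraph V) (XY : SimpleGraph V),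
        0 < ε → ε < 1 → 0 < δ → 0 < γ → 1 ≤ K →
        α = 1 + 3 * ε → β = 1 + ε →
        L = topLevel α β (Fintype.card V) → L' = cutLevel α β L →
        1 ≤ L → 4 / ε ≤ (L : ℝ) ^ 2 →
        IsPartition G α β lev →
        (∀ i ∈ Set.Icc L' L,
          IsSkeleton ε δ γ L (degThreshold α β i) (levelGraph G lev i) (B i) (T i) (S i) (X i)) →
        XY = (⨆ i ∈ Set.Icc L' L, X i) ⊔ (⨆ i ∈ Set.Ico 0 L', levelGraph G lev i) →
        (∀ v, (deg XY v : ℝ) ≤ C * (L : ℝ) ^ 5) ∧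
        (1 / 2 ≤ h₀ ε γ →
          0 < 1 - 32 * δ * (L : ℝ) ^ 4 / ε ^ 2 →
          0 < h₁ α β ε γ - ε - 1 / (K : ℝ) →
          maxMatching XY ≤ maxMatching G ∧
          (maxMatching G : ℝ) ≤ 2 / h₂ α β ε δ γ K L * (1 + ε) * maxMatching XY) := by
  -- `3 * L ^ 5` from the sparsified levels plus `2 * L ^ 4 ≤ 2 * L ^ 5` from the low levels.
  refine ⟨5, by norm_num, ?_⟩
  intro V _ G ε δ γ α β K L L' lev B T S X XY hε hε1 hδ hγ hK hα hβ hLtop hLcut hL hLε hp hs hXY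
  have hL3 := three_le_of_four_div_le hε hε1 hL hLε
  have hL3' : (3 : ℝ) ≤ L := by exact_mod_cast hL3
  have hL' : 1 ≤ L' := by
    rw [hLcut, hα, hβ]
    exact one_le_cutLevel hε hε1 hL3
  have hα1 : 1 ≤ α := by linarith
  have hβ1 : 1 ≤ β := by linarith
  have hs' : ∀ i ∈ Finset.Icc L' L, IsSkeleton ε δ γ L (degThreshold α β i)
      (levelGraph G lev i) (B i) (T i) (S i) (X i) :=
    fun i hi => hs i (by simpa using hi)
  have hXY' : XY = (⨆ i ∈ Finset.Icc L' L, X i) ⊔ (⨆ i ∈ Set.Ico 0 L', levelGraph G lev i) := by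
    rw [hXY]
    simp only [Set.mem_Icc, Finset.mem_Icc]
  refine ⟨fun v => ?_, fun _ ht hh => ⟨maxMatching_mono ?_, ?_⟩⟩
  · have h1 : (deg XY v : ℝ) ≤ deg (⨆ i ∈ Finset.Icc L' L, X i) v +
        deg (⨆ i ∈ Set.Ico 0 L', levelGraph G lev i) v := by
      rw [hXY']
      exact_mod_cast deg_sup_le _ _ v
    have h2 := deg_iSup_skeletons_le (by linarith) (by linarith) hL hL' hs' v
    have h3 := deg_low_levels_le (L' := L') hp (by linarith) hβ1 v
    have h4 : degThreshold α β (L' - 1) ≤ 2 * (L : ℝ) ^ 4 := by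
      rw [hLcut]
      exact degThreshold_cutLevel_sub_one_le (by linarith) (by linarith) hL
    have h5 : (L : ℝ) ^ 4 ≤ (L : ℝ) ^ 5 := pow_le_pow_right₀ (by linarith) (by norm_num)
    linarith
  · rw [hXY']
    refine sup_le (iSup₂_le fun i hi => (hs' i hi).subgraph.trans fun u v h => h.1)
      (iSup₂_le fun i _ u v h => h.1)
  · have h1 := h₁_sub_mul_maxMatching_le hp hs' hXY' hε hε1 hδ hγ hα1 hβ1 hL3 hL' hLtop hLε ht
    have hpos : 0 < h₂ α β ε δ γ K L := mul_pos ht hh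
    have hK0 : 0 < 1 / (K : ℝ) := by
      have : (0 : ℝ) < K := by exact_mod_cast hK
      positivity
    -- The proved constant `h₁ - ε` is stronger: `h₂` subtracts a further `1 / K` and multiplies the
    -- positive result by a factor at most 1.
    have hle : h₂ α β ε δ γ K L ≤ h₁ α β ε γ - ε := by
      have : 0 ≤ 32 * δ * (L : ℝ) ^ 4 / ε ^ 2 := by positivity
      unfold h₂
      nlinarith
    have h2 : h₂ α β ε δ γ K L * maxMatching G ≤ 2 * (1 + ε) * maxMatching XY :=
      (mul_le_mul_of_nonneg_right hle (Nat.cast_nonneg _)).trans h1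
    rw [div_mul_eq_mul_div, div_mul_eq_mul_div, le_div_iff₀ hpos]
    linarith
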